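/- Unit-time IIT scheduling problem. Given release times $r_1,\dots,r_n\ge 0$, deadlines (for the start of a job) $d_1,\dots,d_n\in\mathbb{R}$, and inserted idle-times $(\bar r_\gamma,\bar p_\gamma)$, $\gamma=1,\dots,m$, where for each $\gamma$ either $\bar r_\gamma<\bar p_\gamma$ or $\bar r_\gamma=\bar p_\gamma=0$, a schedule $\mathbf t=(t_1,\dots,t_n)\in\mathbb{R}^n$ is called feasible if (i) $t_j\in[r_j,d_j]$ for all $j$; (ii) $(t_i,t_i+1)\cap(t_j,t_j+1)=\emptyset$ for all $i\neq j$; (iii) $(t_j,t_j+1)\cap(\bar r_\gamma,\bar p_\gamma)=\emptyset$ for all $j$ and $\gamma$. Procedure Polynomial. Let $\mathbf F$ be a finite family of open intervals ("forbidden regions"), initially $\{(\bar r_\gamma-1,\bar p_\gamma):\gamma=1,\dots,m\}$, and let $\sigma$ list the jobs in an increasing order of release times (ties broken arbitrarily). Phase 1 (declaration of forbidden regions). All $c_j$ and $c$ are initially undefined, and $ans=\text{yes}$. For $i=n,n-1,\dots,1$ do the following. For every $j$ with $d_j\ge d_{\sigma_i}$: put $c_j:=d_j$ if $c_j$ is undefined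 and $c_j:=c_j-1$ otherwise; then, while $c_j$ lies in some interval of $\mathbf F$, replace $c_j$ by the infimum of that interval. If $i=1$ or $r_{\sigma_{i-1}}<r_{\sigma_i}$, put $c:=\min\{c_j: c_j\text{ defined}\}$. If $c$ is defined and $c<r_{\sigma_i}$, set $ans:=\text{no}$. If $c$ is defined and $r_{\sigma_i}\le c<r_{\sigma_i}+1$, add the interval $(c-1,r_{\sigma_i})$ to $\mathbf F$. Phase 2 (generation of a schedule). Start with $s=0$ and $\mathcal B=\{1,\dots,n\}$. While $\mathcal B\ne\emptyset$ do the following. While $s$ lies in some interval of $\mathbf F$, replace $s$ by the supremum of that interval. If no $k\in\mathcal B$ has $r_k\le s$, put $s:=\min_{k\in\mathcal B}r_k$ and again move $s$ out of the intervals of $\mathbf F$ in the same way. Let $\mathcal A=\{k\in\mathcal B: r_k\le s\}$, choose $j\in\mathcal A$ with $d_j$ minimal (ties broken arbitrarily), put $t_j:=s$, remove $j$ from $\mathcal B$, and put $s:=s+1$. Let $\pi^*$ list the jobs in an increasing order of $\mathbf t$. Return $(\mathbf t,\pi^*,\text{yes})$ if $ans=\text{yes}$, and $(\emptyset,\pi^*,\text{no})$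 if $ans=\text{no}$. Lemma. For every such instance and every way of breaking the ties, the procedure Polynomial answers "yes" if and only if a feasible schedule exists; if a feasible schedule exists, the schedule $\mathbf t$ that the procedure returns is feasible; and if none exists, it returns no schedule. -/

import Mathlib

/-! Unit-time jobs `j : Fin n` on one machine: release time `r j`, deadline `d j` for the start of
the job, and inserted idle-times `(rbar γ, pbar γ)`, `γ : Fin m`. -/

namespace IITScheduling

/-- `t` is a feasible schedule of start times: every job starts between its release time and its
deadline, the unit intervals occupied by two different jobs do not overlap, and no job runs during
an idle-time. -/
def IsFeasible {n m : ℕ} (r d : Fin n → ℝ) (rbar pbar : Fin m → ℝ) (t : Fin n → ℝ) : Prop :=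
  (∀ j, t j ∈ Set.Icc (r j) (d j)) ∧
  (∀ i j, i ≠ j → Set.Ioo (t i) (t i + 1) ∩ Set.Ioo (t j) (t j + 1) = ∅) ∧
  (∀ j γ, Set.Ioo (t j) (t j + 1) ∩ Set.Ioo (rbar γ) (pbar γ) = ∅)

/-- A finite family of forbidden regions; the pair `(a, b)` stands for the open interval
with these endpoints, in which no job may start. -/
abbrev Regions := List (ℝ × ℝ)

/-- The forbidden regions with which the procedure is initialized: `(rbar γ - 1, pbar γ)`. -/
noncomputable def initialRegions {m : ℕ} (rbar pbar : Fin m → ℝ) : Regions :=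
  List.ofFn fun γ => (rbar γ - 1, pbar γ)

open Classical in
/-- Some region of `F` that contains `x`, if there is one. -/
noncomputable def regionAt (F : Regions) (x : ℝ) : Option (ℝ × ℝ) :=
  F.find? fun I => decide (I.1 < x ∧ x < I.2)

/-- At most `k` rounds of: if `x` lies in a region, move `x` to the infimum of that region. -/
noncomputable def moveDown (F : Regions) : ℕ → ℝ → ℝ
  | 0, x => x
  | k + 1, x =>
    match regionAt F x with
    | some I => moveDown F k I.1
    | none => x

/-- At most `k` rounds of: if `x` lies in a region, move `x` to the supremum of that region. -/
noncomputable def moveUp (F : Regions) : ℕ → ℝ → ℝ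
  | 0, x => x
  | k + 1, x =>
    match regionAt F x with
    | some I => moveUp F k I.2
    | none => x

/-- While `x` lies in a region, move it to the infimum of that region. (A region that has been left
is never entered again, so this takes at most as many rounds as there are regions.) -/
noncomputable def leaveDown (F : Regions) (x : ℝ) : ℝ := moveDown F F.length x

/-- While `x` lies in a region, move it to the supremum of that region. -/
noncomputable def leaveUp (F : Regions) (x : ℝ) : ℝ := moveUp F F.length x

/-! ### First phase: declaration of forbidden regions -/

/-- The variables of the first phase. The value `⊤` of `crit j` or `c` means undefined. -/
structure DeclState (n : ℕ) where
  /-- the forbidden regions declared so far -/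
  F : Regions
  /-- the values `c_j` -/
  crit : Fin n → WithTop ℝ
  /-- the critical time `c` -/
  c : WithTop ℝ
  /-- `false` once the answer has been set to "no" -/
  ans : Bool

open Classical in
/-- The body of the loop over `i`. -/
noncomputable def declStep {n : ℕ} (r d : Fin n → ℝ) (σ : Equiv.Perm (Fin n)) (i : Fin n)
    (st : DeclState n) : DeclState n :=
  -- for every `j` with `d j ≥ d (σ i)`
  let crit : Fin n → WithTop ℝ := fun j =>
    if d (σ i) ≤ d j then
      ((leaveDown st.F (if st.crit j = ⊤ then d j else (st.crit j).untopD 0 - 1) : ℝ) : WithTop ℝ)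
    else st.crit j
  -- if `σ i` is the first job of all, or its predecessor has a smaller release time
  let c : WithTop ℝ :=
    if i.val = 0 ∨ ∃ k : Fin n, k.val + 1 = i.val ∧ r (σ k) < r (σ i) then Finset.univ.inf crit
    else st.c
  { F := if (r (σ i) : WithTop ℝ) ≤ c ∧ c < ((r (σ i) + 1 : ℝ) : WithTop ℝ) then
        (c.untopD 0 - 1, r (σ i)) :: st.F
      else st.F
    crit := crit
    c := c
    ans := if c < (r (σ i) : WithTop ℝ) then false else st.ans }

/-- The first phase: the loop body is executed for the last index first, and for the index `0`
last. -/
noncomputable def declare {n : ℕ} (r d : Fin n → ℝ) (F₀ : Regions) (σ : Equiv.Perm (Fin n)) :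
    DeclState n :=
  (List.finRange n).foldr (declStep r d σ) { F := F₀, crit := fun _ => ⊤, c := ⊤, ans := true }

/-! ### Second phase: generation of a schedule -/

open Classical in
/-- The set `A` of the unscheduled jobs (those in `B`) that are ready at time `s`. -/
noncomputable def ready {n : ℕ} (r : Fin n → ℝ) (B : Finset (Fin n)) (s : ℝ) : Finset (Fin n) :=
  B.filter fun k => r k ≤ s

open Classical in
/-- The time at which the next job is started: `s` is moved out of the forbidden regions; if no job
is ready then, `s` becomes the least release time of an unscheduled job and is moved out of the
forbidden regions again. -/
noncomputable def nextStart {n : ℕ} (r : Fin n → ℝ) (F : Regions) (B : Finset (Fin n))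
    (hB : B.Nonempty) (s : ℝ) : ℝ :=
  if (ready r B (leaveUp F s)).Nonempty then leaveUp F s else leaveUp F (B.inf' hB r)

theorem le_moveUp (F : Regions) (k : ℕ) (x : ℝ) : x ≤ moveUp F k x := by
  induction k generalizing x with
  | zero => exact le_refl x
  | succ k ih =>
    unfold moveUp
    split
    · rename_i I hI
      have h := List.find?_some hI
      have h2 : I.1 < x ∧ x < I.2 := by simpa using h
      exact h2.2.le.trans (ih I.2)
    · exact le_refl x

/-- Some unscheduled job is ready at the time at which the next job is started. -/
theorem ready_nextStart_nonempty {n : ℕ} (r : Fin n → ℝ) (F : Regions) (B : Finset (Fin n))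
    (hB : B.Nonempty) (s : ℝ) : (ready r B (nextStart r F B hB s)).Nonempty := by
  unfold nextStart
  split
  · assumption
  · obtain ⟨j, hj, hjr⟩ := Finset.exists_mem_eq_inf' hB r
    refine ⟨j, ?_⟩
    simp only [ready, Finset.mem_filter]
    exact ⟨hj, hjr ▸ le_moveUp F F.length _⟩

/-- The variables of the second phase: the current time `s`, the set `B` of unscheduled jobs, and
the start times assigned so far. -/
structure GenState (n : ℕ) where
  s : ℝ
  B : Finset (Fin n)
  t : Fin n → ℝ

/-- `pick` implements `argmin` over the deadlines, with an arbitrary way of breaking ties: from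
every nonempty set of jobs it takes one with earliest deadline. -/
def IsEarliestDeadlineRule {n : ℕ} (d : Fin n → ℝ)
    (pick : (A : Finset (Fin n)) → A.Nonempty → Fin n) : Prop :=
  ∀ (A : Finset (Fin n)) (hA : A.Nonempty), pick A hA ∈ A ∧ ∀ k ∈ A, d (pick A hA) ≤ d k

open Classical in
/-- One round of the loop "while `B ≠ ∅`". -/
noncomputable def genStep {n : ℕ} (r : Fin n → ℝ) (F : Regions)
    (pick : (A : Finset (Fin n)) → A.Nonempty → Fin n) (st : GenState n) : GenState n :=
  if hB : st.B.Nonempty then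
    let s := nextStart r F st.B hB st.s
    let j := pick (ready r st.B s) (ready_nextStart_nonempty r F st.B hB st.s)
    { s := s + 1, B := st.B.erase j, t := Function.update st.t j s }
  else st

/-- The second phase. Every round schedules exactly one job, so the loop has `n` rounds. -/
noncomputable def generate {n : ℕ} (r : Fin n → ℝ) (F : Regions)
    (pick : (A : Finset (Fin n)) → A.Nonempty → Fin n) : GenState n :=
  (genStep r F pick)^[n] { s := 0, B := Finset.univ, t := fun _ => 0 }

/-! ### The procedure -/

/-- What the procedure returns: a schedule (or nothing), the jobs in the order of their start
times, and the answer. -/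
structure Output (n : ℕ) where
  schedule : Option (Fin n → ℝ)
  order : Equiv.Perm (Fin n)
  ans : Bool

/-- The procedure, where `σ` lists the jobs in increasing order of their release times. -/
noncomputable def polynomial {n : ℕ} (r d : Fin n → ℝ) (F₀ : Regions) (σ : Equiv.Perm (Fin n))
    (pick : (A : Finset (Fin n)) → A.Nonempty → Fin n) : Output n :=
  let D := declare r d F₀ σ
  let t := (generate r D.F pick).t
  { schedule := if D.ans then some t else none
    order := Tuple.sort t
    ans := D.ans }

end IITScheduling

namespace IITScheduling

/-! ### Leaving the regions -/

/-! Suppose first that a feasible schedule exists. Among any set of jobs with deadlines at most `d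
j`, as many as are counted in `c_j`, one starts no later than `c_j`. Hence some job with release
time at least `r (σ i)` starts at or before `c`. So `c < r (σ i)` cannot occur, and if `c < r (σ i)
+ 1`, a job starting inside `(c - 1, r (σ i))` would still be running when that one starts. By
downward induction on the stage the schedule avoids every declared region and the answer stays "yes"
(`declStage_sound`).

Conversely, suppose the answer is "yes" but the second phase starts a job `q` late. Walk backwards
from `q` through the rounds, as long as the jobs are at least as urgent as `q` and no gap is caused
by missing releases. The critical times of `q` stay below the start times met on the way: going back
one round subtracts one from both, and a jump of the start time over regions passes no critical
time, since these avoid all regions (`avoids_crit`). The walk must stop, for one of two reasons.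
Either time was advanced to at most the releases of all remaining jobs, and then a critical time
lies before a release time, against the answer "yes". Or the preceding job is less urgent than `q`,
so it started before the jobs after it were released, and this start lies in a declared region. Both
are impossible (`IsRun.start_le_deadline`). -/

/-- `x` lies in no region of `F`. -/
def Avoids (F : Regions) (x : ℝ) : Prop := ∀ I ∈ F, ¬ (I.1 < x ∧ x < I.2)

theorem regionAt_eq_none {F : Regions} {x : ℝ} : regionAt F x = none ↔ Avoids F x := by
  simp [regionAt, Avoids]

theorem regionAt_eq_some {F : Regions} {x : ℝ} {I : ℝ × ℝ} (h : regionAt F x = some I) :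
    I ∈ F ∧ I.1 < x ∧ x < I.2 := by
  refine ⟨List.mem_of_find?_eq_some h, ?_⟩
  simpa using List.find?_some h

-- The number of regions ending after the current point bounds the remaining rounds: a move to the
-- supremum of `I` removes `I` from this set and adds nothing.
open Classical in
theorem avoids_moveUp (F : Regions) (k : ℕ) (x : ℝ)
    (h : (F.toFinset.filter fun I => x < I.2).card ≤ k) : Avoids F (moveUp F k x) := by
  induction k generalizing x with
  | zero =>
    intro I hI hx
    have h0 := Finset.card_eq_zero.mp (Nat.le_zero.mp h)
    exact Finset.eq_empty_iff_forall_notMem.mp h0 I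
      (Finset.mem_filter.mpr ⟨List.mem_toFinset.mpr hI, hx.2⟩)
  | succ k ih =>
    unfold moveUp
    split
    · rename_i I hI
      obtain ⟨hIF, -, h2⟩ := regionAt_eq_some hI
      refine ih _ (Nat.le_of_lt_succ (lt_of_lt_of_le (Finset.card_lt_card ?_) h))
      refine Finset.ssubset_iff_of_subset (fun J hJ => ?_) |>.mpr ⟨I, by simp [hIF, h2], by simp⟩
      simp only [Finset.mem_filter] at hJ ⊢
      exact ⟨hJ.1, h2.trans hJ.2⟩
    · rename_i hx
      exact regionAt_eq_none.mp hx

open Classical in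
theorem avoids_moveDown (F : Regions) (k : ℕ) (x : ℝ)
    (h : (F.toFinset.filter fun I => I.1 < x).card ≤ k) : Avoids F (moveDown F k x) := by
  induction k generalizing x with
  | zero =>
    intro I hI hx
    have h0 := Finset.card_eq_zero.mp (Nat.le_zero.mp h)
    exact Finset.eq_empty_iff_forall_notMem.mp h0 I
      (Finset.mem_filter.mpr ⟨List.mem_toFinset.mpr hI, hx.1⟩)
  | succ k ih =>
    unfold moveDown
    split
    · rename_i I hI
      obtain ⟨hIF, h1, -⟩ := regionAt_eq_some hI
      refine ih _ (Nat.le_of_lt_succ (lt_of_lt_of_le (Finset.card_lt_card ?_) h))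
      refine Finset.ssubset_iff_of_subset (fun J hJ => ?_) |>.mpr ⟨I, by simp [hIF, h1], by simp⟩
      simp only [Finset.mem_filter] at hJ ⊢
      exact ⟨hJ.1, hJ.2.trans h1⟩
    · rename_i hx
      exact regionAt_eq_none.mp hx

theorem avoids_leaveUp (F : Regions) (x : ℝ) : Avoids F (leaveUp F x) := by
  classical
  exact avoids_moveUp F _ x ((Finset.card_filter_le _ _).trans (List.toFinset_card_le F))

theorem avoids_leaveDown (F : Regions) (x : ℝ) : Avoids F (leaveDown F x) := by
  classical
  exact avoids_moveDown F _ x ((Finset.card_filter_le _ _).trans (List.toFinset_card_le F))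

theorem moveDown_le (F : Regions) (k : ℕ) (x : ℝ) : moveDown F k x ≤ x := by
  induction k generalizing x with
  | zero => exact le_refl x
  | succ k ih =>
    unfold moveDown
    split
    · rename_i I hI
      exact (ih I.1).trans (regionAt_eq_some hI).2.1.le
    · exact le_refl x

theorem leaveDown_le (F : Regions) (x : ℝ) : leaveDown F x ≤ x := moveDown_le F _ x

theorem le_leaveUp (F : Regions) (x : ℝ) : x ≤ leaveUp F x := le_moveUp F _ x

/-- A downward move cannot jump over a point outside all regions, so `leaveDown F x` is the largest
admissible point up to `x`; `moveUp_le` is the mirror image. -/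
theorem le_moveDown {F : Regions} {y : ℝ} (hy : Avoids F y) (k : ℕ) {x : ℝ} (h : y ≤ x) :
    y ≤ moveDown F k x := by
  induction k generalizing x with
  | zero => exact h
  | succ k ih =>
    unfold moveDown
    split
    · rename_i I hI
      obtain ⟨hIF, -, h2⟩ := regionAt_eq_some hI
      exact ih (not_lt.mp fun h1 => hy I hIF ⟨h1, h.trans_lt h2⟩)
    · exact h

theorem le_leaveDown {F : Regions} {x y : ℝ} (hy : Avoids F y) (h : y ≤ x) :
    y ≤ leaveDown F x := le_moveDown hy _ h

theorem moveUp_le {F : Regions} {y : ℝ} (hy : Avoids F y) (k : ℕ) {x : ℝ} (h : x ≤ y) :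
    moveUp F k x ≤ y := by
  induction k generalizing x with
  | zero => exact h
  | succ k ih =>
    unfold moveUp
    split
    · rename_i I hI
      obtain ⟨hIF, h1, -⟩ := regionAt_eq_some hI
      exact ih (not_lt.mp fun h2 => hy I hIF ⟨h1.trans_le h, h2⟩)
    · exact h

theorem lt_of_lt_leaveUp {F : Regions} {x y : ℝ} (hy : Avoids F y) (h : y < leaveUp F x) :
    y < x :=
  not_le.mp fun hx => absurd (moveUp_le hy _ hx) (not_le.mpr h)

/-! ### The stages of the first phase -/

section Declaration

variable {n : ℕ} (r d : Fin n → ℝ) (F₀ : Regions) (σ : Equiv.Perm (Fin n))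

/-- The state of the first phase when the loop body has been executed exactly for the indices
`i ≥ k`. -/
noncomputable def declStage (k : ℕ) : DeclState n :=
  ((List.finRange n).drop k).foldr (declStep r d σ)
    { F := F₀, crit := fun _ => ⊤, c := ⊤, ans := true }

theorem declStage_zero : declStage r d F₀ σ 0 = declare r d F₀ σ := rfl

theorem declStage_last :
    declStage r d F₀ σ n = { F := F₀, crit := fun _ => ⊤, c := ⊤, ans := true } := by
  rw [declStage, List.drop_of_length_le (by simp), List.foldr_nil]

theorem declStage_eq_declStep (i : Fin n) :
    declStage r d F₀ σ i = declStep r d σ i (declStage r d F₀ σ (i + 1)) := by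
  unfold declStage
  rw [List.drop_eq_getElem_cons (by simp)]
  simp

/-- Downward induction over the stages. -/
theorem stage_induction {P : ℕ → Prop} (last : P n) (step : ∀ i : Fin n, P (i + 1) → P i) :
    ∀ k ≤ n, P k := fun _ hk =>
  Nat.decreasingInduction' (fun i hi _ h => step ⟨i, hi⟩ h) hk last

open Classical in
/-- The jobs among `σ k, σ (k + 1), …` whose deadline is at most that of `j`. -/
noncomputable def urgent (k : ℕ) (j : Fin n) : Finset (Fin n) :=
  Finset.univ.filter fun l => k ≤ (σ.symm l).val ∧ d l ≤ d j

variable {r d F₀ σ}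

theorem mem_urgent {k : ℕ} {j l : Fin n} :
    l ∈ urgent d σ k j ↔ k ≤ (σ.symm l).val ∧ d l ≤ d j := by
  simp [urgent]

theorem urgent_last (j : Fin n) : urgent d σ n j = ∅ := by
  ext l
  simp [mem_urgent]

theorem card_urgent_of_le {i j : Fin n} (h : d (σ i) ≤ d j) :
    (urgent d σ i j).card = (urgent d σ (i + 1) j).card + 1 := by
  rw [← Finset.card_insert_of_notMem (a := σ i) (by simp [mem_urgent])]
  congr 1
  ext l
  rw [Finset.mem_insert, mem_urgent, mem_urgent, ← Equiv.symm_apply_eq, Fin.ext_iff]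
  constructor
  · rintro ⟨h1, h2⟩
    by_cases hl : (σ.symm l).val = i
    · exact Or.inl hl
    · exact Or.inr ⟨by omega, h2⟩
  · rintro (hl | ⟨h1, h2⟩)
    · refine ⟨hl.ge, ?_⟩
      rwa [(Equiv.symm_apply_eq σ).mp (Fin.ext hl)]
    · exact ⟨by omega, h2⟩

theorem urgent_of_lt {i j : Fin n} (h : d j < d (σ i)) :
    urgent d σ i j = urgent d σ (i + 1) j := by
  ext l
  rw [mem_urgent, mem_urgent]
  refine ⟨fun ⟨h1, h2⟩ => ⟨?_, h2⟩, fun ⟨h1, h2⟩ => ⟨by omega, h2⟩⟩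
  by_contra hlt
  have hl : σ.symm l = i := Fin.ext (by omega)
  rw [Equiv.symm_apply_eq] at hl
  exact absurd h2 (not_le.mpr (hl ▸ h))

theorem crit_of_lt {i j : Fin n} (h : d j < d (σ i)) :
    (declStage r d F₀ σ i).crit j = (declStage r d F₀ σ (i + 1)).crit j := by
  rw [declStage_eq_declStep]
  simp [declStep, not_le.mpr h]

theorem crit_of_top {i j : Fin n} (h : d (σ i) ≤ d j)
    (hc : (declStage r d F₀ σ (i + 1)).crit j = ⊤) :
    (declStage r d F₀ σ i).crit j =
      (leaveDown (declStage r d F₀ σ (i + 1)).F (d j) : ℝ) := by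
  rw [declStage_eq_declStep]
  simp [declStep, h, hc]

theorem crit_of_coe {i j : Fin n} (h : d (σ i) ≤ d j) {x : ℝ}
    (hc : (declStage r d F₀ σ (i + 1)).crit j = x) :
    (declStage r d F₀ σ i).crit j =
      (leaveDown (declStage r d F₀ σ (i + 1)).F (x - 1) : ℝ) := by
  rw [declStage_eq_declStep]
  simp [declStep, h, hc]

theorem c_of_first {i : Fin n}
    (h : i.val = 0 ∨ ∃ k : Fin n, k.val + 1 = i.val ∧ r (σ k) < r (σ i)) :
    (declStage r d F₀ σ i).c = Finset.univ.inf (declStage r d F₀ σ i).crit := by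
  rw [declStage_eq_declStep]
  simp only [declStep]
  rw [if_pos h]

theorem c_of_not_first {i : Fin n}
    (h : ¬ (i.val = 0 ∨ ∃ k : Fin n, k.val + 1 = i.val ∧ r (σ k) < r (σ i))) :
    (declStage r d F₀ σ i).c = (declStage r d F₀ σ (i + 1)).c := by
  rw [declStage_eq_declStep]
  simp only [declStep]
  rw [if_neg h]

open Classical in
theorem regions_stage (i : Fin n) :
    (declStage r d F₀ σ i).F =
      if (r (σ i) : WithTop ℝ) ≤ (declStage r d F₀ σ i).c ∧
          (declStage r d F₀ σ i).c < ((r (σ i) + 1 : ℝ) : WithTop ℝ) then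
        ((declStage r d F₀ σ i).c.untopD 0 - 1, r (σ i)) :: (declStage r d F₀ σ (i + 1)).F
      else (declStage r d F₀ σ (i + 1)).F := by
  rw [declStage_eq_declStep]
  rfl

open Classical in
theorem ans_stage (i : Fin n) :
    (declStage r d F₀ σ i).ans =
      if (declStage r d F₀ σ i).c < (r (σ i) : WithTop ℝ) then false
      else (declStage r d F₀ σ (i + 1)).ans := by
  rw [declStage_eq_declStep]
  rfl

theorem regions_cases {i : Fin n} {I : ℝ × ℝ} (hI : I ∈ (declStage r d F₀ σ i).F) :
    I ∈ (declStage r d F₀ σ (i + 1)).F ∨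
      ∃ c : ℝ, (declStage r d F₀ σ i).c = c ∧ I = (c - 1, r (σ i)) := by
  rw [regions_stage] at hI
  split_ifs at hI with h
  · rcases List.mem_cons.mp hI with rfl | hI
    · obtain ⟨c, hc⟩ := WithTop.ne_top_iff_exists.mp (h.2.trans_le le_top).ne
      exact Or.inr ⟨c, hc.symm, by simp [← hc]⟩
    · exact Or.inl hI
  · exact Or.inl hI

theorem regions_subset_stage (i : Fin n) :
    (declStage r d F₀ σ (i + 1)).F ⊆ (declStage r d F₀ σ i).F := by
  rw [regions_stage]
  split_ifs
  · exact List.subset_cons_self _ _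
  · exact List.Subset.refl _

theorem region_mem_stage {i : Fin n} {c : ℝ} (hc : (declStage r d F₀ σ i).c = c)
    (h1 : r (σ i) ≤ c) (h2 : c < r (σ i) + 1) :
    (c - 1, r (σ i)) ∈ (declStage r d F₀ σ i).F := by
  rw [regions_stage, hc, if_pos ⟨by exact_mod_cast h1, by exact_mod_cast h2⟩]
  simp

/-- Every value `c_j` is `⊤` as long as there is no urgent job, and at most `d j` afterwards. -/
theorem crit_top_or_le (j : Fin n) : ∀ k ≤ n,
    (urgent d σ k j = ∅ ∧ (declStage r d F₀ σ k).crit j = ⊤) ∨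
      ((urgent d σ k j).Nonempty ∧ ∃ x : ℝ, (declStage r d F₀ σ k).crit j = x ∧ x ≤ d j) := by
  refine stage_induction (Or.inl ⟨urgent_last j, by rw [declStage_last]⟩) fun i ih => ?_
  rcases le_or_gt (d (σ i)) (d j) with h | h
  · refine Or.inr ⟨Finset.card_pos.mp (by rw [card_urgent_of_le h]; omega), ?_⟩
    rcases ih with ⟨-, ih⟩ | ⟨-, x, hx, hxd⟩
    · exact ⟨_, crit_of_top h ih, leaveDown_le _ _⟩
    · refine ⟨_, crit_of_coe h hx, (leaveDown_le _ _).trans (by linarith)⟩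
  · rwa [urgent_of_lt h, crit_of_lt h]

/-! ### A feasible schedule starts no job in a declared region -/

/-- Induction step for the bound by `c_j`. Removing the earliest job of `U` leaves a set of the
previous size, one of whose jobs starts by the old value; the removed job starts at least one unit
before that. The set `U` must be arbitrary, as the removed job need not be `σ i`. -/
theorem exists_start_le_crit {t : Fin n → ℝ} (htd : ∀ j, t j ≤ d j)
    (hdist : ∀ i j, i ≠ j → t i ≤ t j → t i + 1 ≤ t j) (j i : Fin n)
    (hF : ∀ l, Avoids (declStage r d F₀ σ (i + 1)).F (t l))
    (ih : ∀ U : Finset (Fin n), U.Nonempty → U.card = (urgent d σ (i + 1) j).card →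
      (∀ l ∈ U, d l ≤ d j) → ∃ l ∈ U, (t l : WithTop ℝ) ≤ (declStage r d F₀ σ (i + 1)).crit j)
    (U : Finset (Fin n)) (hU : U.Nonempty) (hcard : U.card = (urgent d σ i j).card)
    (hUd : ∀ l ∈ U, d l ≤ d j) :
    ∃ l ∈ U, (t l : WithTop ℝ) ≤ (declStage r d F₀ σ i).crit j := by
  rcases le_or_gt (d (σ i)) (d j) with h | h
  · obtain ⟨l₀, hl₀, hmin⟩ := U.exists_min_image t hU
    refine ⟨l₀, hl₀, ?_⟩
    rcases crit_top_or_le (r := r) (F₀ := F₀) (σ := σ) j (i + 1) i.isLt with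
      ⟨-, hc⟩ | ⟨hne, x, hx, -⟩
    · rw [crit_of_top h hc]
      exact_mod_cast le_leaveDown (hF l₀) ((htd l₀).trans (hUd l₀ hl₀))
    · have hcard' : (U.erase l₀).card = (urgent d σ (i + 1) j).card := by
        rw [Finset.card_erase_of_mem hl₀, hcard, card_urgent_of_le h]
        simp
      obtain ⟨l, hl, hlx⟩ := ih (U.erase l₀)
        (Finset.card_pos.mp (hcard' ▸ Finset.card_pos.mpr hne)) hcard'
        fun l hl => hUd l (Finset.mem_of_mem_erase hl)
      rw [hx] at hlx
      have hlx' : t l ≤ x := by exact_mod_cast hlx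
      have h1 := hdist l₀ l (Finset.ne_of_mem_erase hl).symm (hmin l (Finset.mem_of_mem_erase hl))
      rw [crit_of_coe h hx]
      exact_mod_cast le_leaveDown (hF l₀) (by linarith)
  · rw [crit_of_lt h]
    exact ih U hU (hcard.trans (by rw [urgent_of_lt h])) hUd

/-- The invariant of the first phase with respect to a feasible schedule `t`. -/
theorem declStage_sound (hσ : Monotone (r ∘ σ)) {t : Fin n → ℝ} (hrt : ∀ j, r j ≤ t j)
    (htd : ∀ j, t j ≤ d j) (hdist : ∀ i j, i ≠ j → t i ≤ t j → t i + 1 ≤ t j)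
    (h₀ : ∀ l, Avoids F₀ (t l)) : ∀ k ≤ n,
    (∀ l, Avoids (declStage r d F₀ σ k).F (t l)) ∧
    (∀ j, ∀ U : Finset (Fin n), U.Nonempty → U.card = (urgent d σ k j).card →
      (∀ l ∈ U, d l ≤ d j) → ∃ l ∈ U, (t l : WithTop ℝ) ≤ (declStage r d F₀ σ k).crit j) ∧
    ((declStage r d F₀ σ k).c = ⊤ ∨
      ∃ a : Fin n, k ≤ a.val ∧ (t (σ a) : WithTop ℝ) ≤ (declStage r d F₀ σ k).c) ∧
    (declStage r d F₀ σ k).ans = true := by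
  refine stage_induction ⟨?_, ?_, Or.inl ?_, ?_⟩ fun i ih => ?_
  · rwa [declStage_last]
  · intro j U hU hcard
    rw [urgent_last, Finset.card_empty] at hcard
    exact absurd hcard (Finset.card_pos.mpr hU).ne'
  · rw [declStage_last]
  · rw [declStage_last]
  · obtain ⟨hF, hcrit, hc, hans⟩ := ih
    have hcrit' := fun j => exists_start_le_crit htd hdist j i hF (hcrit j)
    have hc' : (declStage r d F₀ σ i).c = ⊤ ∨
        ∃ a : Fin n, i.val ≤ a.val ∧ (t (σ a) : WithTop ℝ) ≤ (declStage r d F₀ σ i).c := by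
      by_cases hfirst : i.val = 0 ∨ ∃ k : Fin n, k.val + 1 = i.val ∧ r (σ k) < r (σ i)
      · rw [c_of_first hfirst]
        -- The minimum is attained at some `j`; if it is finite, the bound applies to the urgent
        -- jobs of `j` themselves, all of index at least `i`.
        obtain ⟨j, -, hj⟩ := Finset.exists_mem_eq_inf Finset.univ ⟨i, Finset.mem_univ i⟩
          (declStage r d F₀ σ i).crit
        rw [hj]
        rcases crit_top_or_le (r := r) (F₀ := F₀) (σ := σ) j i i.isLt.le with
          ⟨-, htop⟩ | ⟨hne, -⟩
        · exact Or.inl htop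
        · obtain ⟨l, hl, hlt⟩ := hcrit' j _ hne rfl fun l hl => (mem_urgent.mp hl).2
          exact Or.inr ⟨σ.symm l, (mem_urgent.mp hl).1, by simpa using hlt⟩
      -- Here `c` is carried over from a later index, and so is its witness `a`.
      · rw [c_of_not_first hfirst]
        exact hc.imp_right fun ⟨a, ha, hta⟩ => ⟨a, by omega, hta⟩
    refine ⟨fun l I hI hlI => ?_, hcrit', hc', ?_⟩
    · rcases regions_cases hI with hI | ⟨c, hcc, rfl⟩
      · exact hF l I hI hlI
      · rw [hcc] at hc'
        obtain htop | ⟨a, ha, hta⟩ := hc'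
        · exact absurd htop (WithTop.coe_ne_top)
        · have hta' : t (σ a) ≤ c := by exact_mod_cast hta
          have h1 : r (σ i) ≤ r (σ a) := hσ (Fin.le_def.mpr ha)
          have h2 := hrt (σ a)
          simp only at hlI
          -- Since `t l < r (σ i) ≤ t (σ a) ≤ c`, job `l` must end by `c`, contrary to `c - 1 < t
          -- l`.
          have h3 := hdist l (σ a) (by rintro rfl; linarith) (by linarith)
          linarith
    · rw [ans_stage, hans, if_neg]
      rcases hc' with htop | ⟨a, ha, hta⟩
      · simp [htop]
      · refine not_lt.mpr (le_trans ?_ hta)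
        have h1 : r (σ i) ≤ r (σ a) := hσ (Fin.le_def.mpr ha)
        exact_mod_cast h1.trans (hrt (σ a))

/-! ### The critical times of a successful first phase -/

theorem regions_subset {k : ℕ} (hk : k ≤ n) :
    (declStage r d F₀ σ k).F ⊆ (declStage r d F₀ σ 0).F := by
  induction k with
  | zero => exact List.Subset.refl _
  | succ k ih => exact List.Subset.trans (regions_subset_stage ⟨k, hk⟩) (ih (by omega))

theorem ans_stage_of_ans (hans : (declStage r d F₀ σ 0).ans = true) {k : ℕ} (hk : k ≤ n) :
    (declStage r d F₀ σ k).ans = true := by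
  induction k with
  | zero => exact hans
  | succ k ih =>
    have h := ih (by omega)
    have h' := ans_stage (r := r) (d := d) (F₀ := F₀) (σ := σ) ⟨k, hk⟩
    simp only [h] at h'
    split_ifs at h'
    exact h'.symm

theorem le_c_of_ans (hans : (declStage r d F₀ σ 0).ans = true) (i : Fin n) :
    (r (σ i) : WithTop ℝ) ≤ (declStage r d F₀ σ i).c := by
  have h := ans_stage_of_ans hans i.isLt.le
  rw [ans_stage] at h
  split_ifs at h with hc
  exact not_lt.mp hc

theorem crit_stage_le (i j : Fin n) :
    (declStage r d F₀ σ i).crit j ≤ (declStage r d F₀ σ (i + 1)).crit j := by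
  rcases le_or_gt (d (σ i)) (d j) with h | h
  · rcases crit_top_or_le (r := r) (F₀ := F₀) (σ := σ) j (i + 1) i.isLt with
      ⟨-, hc⟩ | ⟨-, x, hx, -⟩
    · rw [hc]
      exact le_top
    · rw [crit_of_coe h hx, hx]
      have := leaveDown_le (declStage r d F₀ σ (i + 1)).F (x - 1)
      exact_mod_cast this.trans (by linarith)
  · rw [crit_of_lt h]

/-- Below every critical time at stage `i` there is a critical time `c` that is not less than the
release time, and whose region is declared. -/
theorem exists_declared_le_crit (hσ : Monotone (r ∘ σ))
    (hans : (declStage r d F₀ σ 0).ans = true) (j : Fin n) {x : ℝ} (k : ℕ) (hk : k < n)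
    (hx : (declStage r d F₀ σ k).crit j ≤ x) :
    ∃ c : ℝ, c ≤ x ∧ r (σ ⟨k, hk⟩) ≤ c ∧
      (c < r (σ ⟨k, hk⟩) + 1 → (c - 1, r (σ ⟨k, hk⟩)) ∈ (declStage r d F₀ σ 0).F) := by
  have first : ∀ i : Fin n,
      (i.val = 0 ∨ ∃ k : Fin n, k.val + 1 = i.val ∧ r (σ k) < r (σ i)) →
      (declStage r d F₀ σ i).crit j ≤ x → ∃ c : ℝ, c ≤ x ∧ r (σ i) ≤ c ∧
        (c < r (σ i) + 1 → (c - 1, r (σ i)) ∈ (declStage r d F₀ σ 0).F) := by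
    intro i hi hx
    have hle : (declStage r d F₀ σ i).c ≤ x := by
      rw [c_of_first hi]
      exact (Finset.inf_le (Finset.mem_univ j)).trans hx
    obtain ⟨c, hc⟩ := WithTop.ne_top_iff_exists.mp (hle.trans_lt (WithTop.coe_lt_top x)).ne
    have hrc := le_c_of_ans hans i
    rw [← hc] at hle hrc
    have hrc' : r (σ i) ≤ c := by exact_mod_cast hrc
    exact ⟨c, by exact_mod_cast hle, hrc', fun h =>
      regions_subset i.isLt.le (region_mem_stage hc.symm hrc' h)⟩
  induction k with
  | zero => exact first ⟨0, hk⟩ (Or.inl rfl) hx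
  | succ k ih =>
    have hmono : r (σ ⟨k, by omega⟩) ≤ r (σ ⟨k + 1, hk⟩) := hσ (Fin.le_def.mpr (Nat.le_succ k))
    rcases hmono.lt_or_eq with h | h
    · exact first ⟨k + 1, hk⟩ (Or.inr ⟨⟨k, by omega⟩, rfl, h⟩) hx
    -- Within a block of equal release times `c` is renewed only at the first index, and `c_j` can
    -- only have decreased by then.
    · rw [← h]
      exact ih (by omega) ((crit_stage_le ⟨k, by omega⟩ j).trans hx)

/-- Regions declared after stage `k` end at the release time of a job of smaller index; this keeps
them below the critical times of stage `k`. -/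
theorem mem_regions_or {I : ℝ × ℝ} (hI : I ∈ (declStage r d F₀ σ 0).F) {k : ℕ} (hk : k ≤ n) :
    I ∈ (declStage r d F₀ σ k).F ∨ ∃ a : Fin n, a.val < k ∧ I.2 = r (σ a) := by
  induction k with
  | zero => exact Or.inl hI
  | succ k ih =>
    rcases ih (by omega) with h | ⟨a, ha, haI⟩
    · rcases regions_cases (i := ⟨k, hk⟩) h with h | ⟨c, -, rfl⟩
      · exact Or.inl h
      · exact Or.inr ⟨⟨k, hk⟩, Nat.lt_succ_self k, rfl⟩
    · exact Or.inr ⟨a, by omega, haI⟩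

/-- If the first phase succeeds, then the critical times avoid all regions, including those that
are declared later. -/
theorem avoids_crit (hσ : Monotone (r ∘ σ)) (hans : (declStage r d F₀ σ 0).ans = true)
    (j : Fin n) : ∀ k ≤ n, ∀ x : ℝ, (declStage r d F₀ σ k).crit j = x →
      Avoids (declStage r d F₀ σ 0).F x := by
  refine stage_induction (fun x hx => ?_) fun i ih x hx => ?_
  · rw [declStage_last] at hx
    exact absurd hx WithTop.top_ne_coe
  rcases le_or_gt (d (σ i)) (d j) with h | h
  · have hav : Avoids (declStage r d F₀ σ (i + 1)).F x := by
      rcases crit_top_or_le (r := r) (F₀ := F₀) (σ := σ) j (i + 1) i.isLt with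
        ⟨-, hc⟩ | ⟨-, y, hy, -⟩
      · rw [crit_of_top h hc, WithTop.coe_inj] at hx
        exact hx ▸ avoids_leaveDown _ _
      · rw [crit_of_coe h hy, WithTop.coe_inj] at hx
        exact hx ▸ avoids_leaveDown _ _
    intro I hI hxI
    rcases mem_regions_or hI i.isLt with hI | ⟨a, ha, haI⟩
    · exact hav I hI hxI
    · obtain ⟨c, hcx, hrc, -⟩ := exists_declared_le_crit hσ hans j i i.isLt hx.le
      have h1 : r (σ a) ≤ r (σ i) := hσ (Fin.le_def.mpr (by omega))
      have h2 := hxI.2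
      simp only [Fin.eta] at hrc
      linarith
  · exact ih x (by rw [← crit_of_lt h, hx])

/-- The critical time of `j` at every stage with more than `L` urgent jobs is less than `a`. -/
def CritBelow (r d : Fin n → ℝ) (F₀ : Regions) (σ : Equiv.Perm (Fin n)) (j : Fin n) (L : ℕ)
    (a : ℝ) : Prop :=
  ∀ k ≤ n, L < (urgent d σ k j).card → ∃ x : ℝ, (declStage r d F₀ σ k).crit j = x ∧ x < a

theorem critBelow_zero {j : Fin n} {a : ℝ} (h : d j < a) : CritBelow r d F₀ σ j 0 a := by
  intro k hk hcard
  rcases crit_top_or_le (r := r) (d := d) (F₀ := F₀) (σ := σ) j k hk with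
    ⟨he, -⟩ | ⟨-, x, hx, hxd⟩
  · simp [he] at hcard
  · exact ⟨x, hx, hxd.trans_lt h⟩

/-- `leaveUp` passes over no point outside the regions, and critical times are such points. -/
theorem CritBelow.of_leaveUp (hσ : Monotone (r ∘ σ)) (hans : (declStage r d F₀ σ 0).ans = true)
    {j : Fin n} {L : ℕ} {z : ℝ}
    (h : CritBelow r d F₀ σ j L (leaveUp (declStage r d F₀ σ 0).F z)) :
    CritBelow r d F₀ σ j L z := by
  intro k hk hcard
  obtain ⟨x, hx, hlt⟩ := h k hk hcard
  exact ⟨x, hx, lt_of_lt_leaveUp (avoids_crit hσ hans j k hk x hx) hlt⟩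

/-- Each further urgent job lowers `c_j` by at least one; a less urgent job changes neither the
count nor `c_j`. -/
theorem CritBelow.succ {j : Fin n} {L : ℕ} {z : ℝ} (h : CritBelow r d F₀ σ j L (z + 1)) :
    CritBelow r d F₀ σ j (L + 1) z := by
  refine stage_induction (fun hcard => ?_) fun i ih hcard => ?_
  · simp [urgent_last] at hcard
  rcases le_or_gt (d (σ i)) (d j) with hi | hi
  · rw [card_urgent_of_le hi] at hcard
    obtain ⟨x, hx, hlt⟩ := h (i + 1) i.isLt (by omega)
    refine ⟨_, crit_of_coe hi hx, ?_⟩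
    have := leaveDown_le (declStage r d F₀ σ (i + 1)).F (x - 1)
    linarith
  · rw [urgent_of_lt hi] at hcard
    rw [crit_of_lt hi]
    exact ih hcard

/-- If there are more than `L` jobs with deadlines at most `d j`, then at the stage at which the
last one of them is taken up the critical time of `j` yields a region. -/
theorem CritBelow.exists_declared (hσ : Monotone (r ∘ σ))
    (hans : (declStage r d F₀ σ 0).ans = true) {j : Fin n} {L : ℕ} {z : ℝ}
    (h : CritBelow r d F₀ σ j L z) {J : Finset (Fin n)} (hJ : L < J.card)
    (hJd : ∀ l ∈ J, d l ≤ d j) :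
    ∃ l ∈ J, ∃ c < z, r l ≤ c ∧
      (c < r l + 1 → (c - 1, r l) ∈ (declStage r d F₀ σ 0).F) := by
  -- The first phase runs downwards, so the job taken up last has the smallest index.
  obtain ⟨l, hl, hmin⟩ := J.exists_min_image (fun l => (σ.symm l).val)
    (Finset.card_pos.mp (by omega))
  have hsub : J ⊆ urgent d σ (σ.symm l).val j := fun a ha =>
    mem_urgent.mpr ⟨hmin a ha, hJd a ha⟩
  obtain ⟨x, hx, hxz⟩ := h _ (σ.symm l).isLt.le (hJ.trans_le (Finset.card_le_card hsub))
  obtain ⟨c, hcx, h1, h2⟩ := exists_declared_le_crit hσ hans j _ (σ.symm l).isLt hx.le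
  simp only [Fin.eta, Equiv.apply_symm_apply] at h1 h2
  exact ⟨l, hl, c, hcx.trans_lt hxz, h1, h2⟩

end Declaration

/-! ### The second phase -/

section Generation

variable {n : ℕ} {r d : Fin n → ℝ} {F : Regions}
  {pick : (A : Finset (Fin n)) → A.Nonempty → Fin n}

/-- Keeps only what the backward walk needs: the point `z` from which regions are left is the old
time or precedes all open releases. -/
theorem nextStart_spec (B : Finset (Fin n)) (hB : B.Nonempty) (s : ℝ) :
    s ≤ nextStart r F B hB s ∧
      ∃ z, nextStart r F B hB s = leaveUp F z ∧ (z = s ∨ ∀ l ∈ B, z ≤ r l) := by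
  unfold nextStart
  split_ifs with h
  · exact ⟨le_leaveUp F s, s, rfl, Or.inl rfl⟩
  · refine ⟨?_, _, rfl, Or.inr fun l hl => Finset.inf'_le r hl⟩
    refine le_trans ((Finset.le_inf'_iff hB r).mpr fun l hl => ?_) (le_leaveUp F _)
    by_contra hlt
    exact h ⟨l, by
      classical
      exact Finset.mem_filter.mpr ⟨hl, (not_le.mp hlt).le.trans (le_leaveUp F s)⟩⟩

open Classical in
theorem genStep_spec (hpick : IsEarliestDeadlineRule d pick) (st : GenState n)
    (hB : st.B.Nonempty) : ∃ (s : ℝ) (j : Fin n),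
      genStep r F pick st =
        { s := s + 1, B := st.B.erase j, t := Function.update st.t j s } ∧
      j ∈ st.B ∧ r j ≤ s ∧ (∀ l ∈ st.B, r l ≤ s → d j ≤ d l) ∧ st.s ≤ s ∧
      ∃ z, s = leaveUp F z ∧ (z = st.s ∨ ∀ l ∈ st.B, z ≤ r l) := by
  obtain ⟨h1, h2⟩ := hpick _ (ready_nextStart_nonempty r F st.B hB st.s)
  have h3 := Finset.mem_filter.mp h1
  refine ⟨_, _, by rw [genStep, dif_pos hB], h3.1, h3.2, fun l hl hls => ?_,
    nextStart_spec st.B hB st.s⟩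
  exact h2 l (Finset.mem_filter.mpr ⟨hl, hls⟩)

/-- The course of the second phase: in round `k` the job `job k` is started at time `start k`. -/
structure IsRun (r d : Fin n → ℝ) (F : Regions) (start : Fin n → ℝ) (job : Fin n → Fin n) :
    Prop where
  bijective : Function.Bijective job
  release_le (k : Fin n) : r (job k) ≤ start k
  earliest_deadline (k l : Fin n) : k ≤ l → r (job l) ≤ start k → d (job k) ≤ d (job l)
  add_one_le (k l : Fin n) : k < l → start k + 1 ≤ start l
  eq_leaveUp (k : Fin n) : ∃ z, start k = leaveUp F z ∧
    ((∀ l, k ≤ l → z ≤ r (job l)) ∨ ∃ k' : Fin n, k'.val + 1 = k ∧ z = start k' + 1)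

theorem exists_isRun (hr : ∀ j, 0 ≤ r j) (hpick : IsEarliestDeadlineRule d pick) :
    ∃ start job, IsRun r d F start job ∧
      ∀ k, (generate r F pick).t (job k) = start k := by
  classical
  set st : ℕ → GenState n := fun k =>
    (genStep r F pick)^[k] { s := 0, B := Finset.univ, t := fun _ => 0 } with hst
  have st_succ : ∀ k, st (k + 1) = genStep r F pick (st k) := fun k =>
    Function.iterate_succ_apply' _ _ _
  have hcard : ∀ k ≤ n, (st k).B.card = n - k := by
    intro k
    induction k with
    | zero => intro _; simp [hst]
    | succ k ih =>
      intro hk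
      have h := ih (by omega)
      obtain ⟨s, j, h1, h2, -⟩ := genStep_spec (r := r) (F := F) hpick (st k)
        (Finset.card_pos.mp (by omega))
      rw [st_succ, h1]
      simp only [Finset.card_erase_of_mem h2, h]
      omega
  have hne : ∀ k : Fin n, (st k).B.Nonempty := fun k =>
    Finset.card_pos.mp (by rw [hcard k k.isLt.le]; omega)
  choose start job hstep hmem hrel hearl hle z hz hz' using fun k : Fin n =>
    genStep_spec (r := r) (F := F) hpick (st k) (hne k)
  have hsucc : ∀ k : Fin n, st (k + 1) =
      { s := start k + 1, B := (st k).B.erase (job k),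
        t := Function.update (st k).t (job k) (start k) } := fun k => by
    rw [st_succ, hstep]
  have hanti : ∀ k l : ℕ, k ≤ l → l ≤ n → (st l).B ⊆ (st k).B := by
    intro k l hkl
    induction l, hkl using Nat.le_induction with
    | base => exact fun _ => Finset.Subset.refl _
    | succ l hkl ih =>
      intro hl
      rw [hsucc ⟨l, hl⟩]
      exact fun a ha => ih (by omega) (Finset.mem_of_mem_erase ha)
  have hjob_mem : ∀ k l : Fin n, k ≤ l → job l ∈ (st k).B := fun k l hkl =>
    hanti k l hkl l.isLt.le (hmem l)
  have hjob_ne : ∀ k l : Fin n, k < l → job l ≠ job k := fun k l hkl => by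
    have h := hanti (k + 1) l hkl l.isLt.le (hmem l)
    rw [hsucc k] at h
    exact Finset.ne_of_mem_erase h
  have hinj : Function.Injective job := fun k l h => by
    rcases lt_trichotomy k l with hkl | hkl | hkl
    · exact absurd h.symm (hjob_ne k l hkl)
    · exact hkl
    · exact absurd h (hjob_ne l k hkl)
  have hadd : ∀ k l : Fin n, k < l → start k + 1 ≤ start l := by
    have hs : ∀ k : Fin n, ∀ l : ℕ, k.val + 1 ≤ l → l ≤ n → start k + 1 ≤ (st l).s := by
      intro k l hkl
      induction l, hkl using Nat.le_induction with
      | base => intro _; rw [hsucc k]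
      | succ l hkl ih =>
        intro hl
        have h1 := ih (by omega)
        have h2 := hle ⟨l, hl⟩
        rw [hsucc ⟨l, hl⟩]
        simp only at h2 ⊢
        linarith
    exact fun k l hkl => (hs k l hkl l.isLt.le).trans (hle l)
  refine ⟨start, job, ⟨Finite.injective_iff_bijective.mp hinj, hrel,
    fun k l hkl => hearl k _ (hjob_mem k l hkl), hadd, fun k => ⟨z k, hz k, ?_⟩⟩, fun k => ?_⟩
  · rcases hz' k with h | h
    · obtain ⟨k, hk⟩ := k
      cases k with
      | zero =>
        -- The first round has no predecessor, but starts from time `0`, which precedes all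
        -- releases.
        refine Or.inl fun l _ => ?_
        rw [h]
        exact hr _
      | succ k =>
        refine Or.inr ⟨⟨k, by omega⟩, rfl, ?_⟩
        rw [h, hsucc ⟨k, by omega⟩]
    · exact Or.inl fun l hl => h _ (hjob_mem k l hl)
  · have ht : ∀ l : ℕ, k.val + 1 ≤ l → l ≤ n → (st l).t (job k) = start k := by
      intro l hkl
      induction l, hkl using Nat.le_induction with
      | base => intro _; rw [hsucc k]; simp
      | succ l hkl ih =>
        intro hl
        rw [hsucc ⟨l, hl⟩]
        simp only
        rw [Function.update_of_ne (hjob_ne k ⟨l, hl⟩ (Fin.lt_def.mpr hkl)).symm]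
        exact ih (by omega)
    exact ht n k.isLt le_rfl

/-- If the first phase succeeds, no job in the second phase is late. -/
theorem IsRun.start_le_deadline {F₀ : Regions} {σ : Equiv.Perm (Fin n)} (hσ : Monotone (r ∘ σ))
    (hans : (declStage r d F₀ σ 0).ans = true) {start : Fin n → ℝ} {job : Fin n → Fin n}
    (h : IsRun r d (declStage r d F₀ σ 0).F start job) (q : Fin n) :
    start q ≤ d (job q) := by
  by_contra! hlate
  -- The backward walk, by strong induction on the round `w` it has reached. Rounds `w` to `q`
  -- contain `q - w + 1` jobs, hence the threshold `q - w`.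
  have key : ∀ w : ℕ, ∀ hw : w ≤ q.val,
      (∀ k : Fin n, w ≤ k.val → k ≤ q → d (job k) ≤ d (job q)) →
      ¬ CritBelow r d F₀ σ (job q) (q - w) (start ⟨w, by omega⟩) := by
    intro w
    induction w using Nat.strong_induction_on with
    | _ w ih =>
    intro hw hd hbelow
    obtain ⟨z, hz, hz'⟩ := h.eq_leaveUp ⟨w, by omega⟩
    rw [hz] at hbelow
    have hbelow' := hbelow.of_leaveUp hσ hans
    have hex := hbelow'.exists_declared hσ hans
      (J := (Finset.Icc (⟨w, by omega⟩ : Fin n) q).image job)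
      (by
        rw [Finset.card_image_of_injective _ h.bijective.injective, Fin.card_Icc]
        simp only
        omega)
      (by
        simp only [Finset.mem_image, Finset.mem_Icc, forall_exists_index, and_imp]
        rintro _ k hk1 hk2 rfl
        exact hd k hk1 hk2)
    obtain ⟨l, hl, c, hcz, hrc, hreg⟩ := hex
    obtain ⟨k, hk, rfl⟩ := Finset.mem_image.mp hl
    obtain ⟨hwk, hkq⟩ := Finset.mem_Icc.mp hk
    rcases hz' with hz' | ⟨p, hp, rfl⟩
    · have := hz' k hwk
      linarith
    · simp only at hp
      rcases le_or_gt (d (job p)) (d (job q)) with hdp | hdp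
      · refine ih p (by omega) (by omega) (fun a ha haq => ?_) ?_
        · rcases Nat.eq_or_lt_of_le ha with hap | hap
          · rwa [← Fin.ext hap]
          · exact hd a (by omega) haq
        · have := hbelow'.succ
          rwa [show q.val - w + 1 = q.val - p by omega] at this
      -- Job `p` is less urgent than `job k` but was chosen, so `job k` was not yet released. With
      -- `c < start p + 1` this puts `start p` inside `(c - 1, r (job k))`.
      · have hpk : p ≤ k := Fin.le_def.mpr (by have := Fin.le_def.mp hwk; simp only at this; omega)
        have hrk : start p < r (job k) := by
          by_contra! hle
          have h1 := h.earliest_deadline p k hpk hle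
          have h2 := hd k hwk hkq
          linarith
        obtain ⟨y, hy, -⟩ := h.eq_leaveUp p
        exact (hy ▸ avoids_leaveUp _ y : Avoids _ (start p)) _ (hreg (by linarith))
          ⟨by simp only; linarith, hrk⟩
  refine key q le_rfl (fun k h1 h2 => ?_) ?_
  · rw [le_antisymm h2 h1]
  · simpa using critBelow_zero hlate

end Generation

/-! ### Feasible schedules -/

section Feasibility

variable {n m : ℕ} {r d : Fin n → ℝ} {rbar pbar : Fin m → ℝ}

theorem Ioo_inter_Ioo_eq_empty_of_add_one_le {x y : ℝ} (h : x + 1 ≤ y) :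
    Set.Ioo x (x + 1) ∩ Set.Ioo y (y + 1) = ∅ := by
  ext a
  simp only [Set.mem_inter_iff, Set.mem_Ioo, Set.mem_empty_iff_false, iff_false, not_and, and_imp]
  intros
  linarith

theorem add_one_le_of_Ioo_inter_Ioo_eq_empty {x y : ℝ} (hxy : x ≤ y)
    (h : Set.Ioo x (x + 1) ∩ Set.Ioo y (y + 1) = ∅) : x + 1 ≤ y := by
  by_contra! hlt
  obtain ⟨a, ha1, ha2⟩ := exists_between hlt
  exact Set.eq_empty_iff_forall_notMem.mp h a
    ⟨⟨by linarith, ha2⟩, ⟨ha1, by linarith⟩⟩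

/-- A unit job starting in `(rbar γ - 1, pbar γ)` overlaps a nonempty idle-time. The degenerate case
gives the region `(-1, 0)`, which contains no nonnegative time. -/
theorem IsFeasible.avoids {t : Fin n → ℝ} (hr : ∀ j, 0 ≤ r j)
    (hidle : ∀ γ, rbar γ < pbar γ ∨ (rbar γ = 0 ∧ pbar γ = 0))
    (h : IsFeasible r d rbar pbar t) (l : Fin n) : Avoids (initialRegions rbar pbar) (t l) := by
  intro I hI hlI
  obtain ⟨γ, rfl⟩ := (List.mem_ofFn' _ _).mp hI
  simp only at hlI
  rcases hidle γ with hγ | ⟨-, hγ⟩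
  · have hlt : max (t l) (rbar γ) < min (t l + 1) (pbar γ) :=
      max_lt (lt_min (by linarith) hlI.2) (lt_min (by linarith) hγ)
    obtain ⟨a, ha1, ha2⟩ := exists_between hlt
    rw [max_lt_iff] at ha1
    rw [lt_min_iff] at ha2
    exact Set.eq_empty_iff_forall_notMem.mp (h.2.2 l γ) a ⟨⟨ha1.1, ha2.1⟩, ⟨ha1.2, ha2.2⟩⟩
  · have := hr l
    have := (h.1 l).1
    linarith

theorem inter_idle_eq_empty {x : ℝ} (hx : Avoids (initialRegions rbar pbar) x) (γ : Fin m) :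
    Set.Ioo x (x + 1) ∩ Set.Ioo (rbar γ) (pbar γ) = ∅ := by
  ext a
  simp only [Set.mem_inter_iff, Set.mem_Ioo, Set.mem_empty_iff_false, iff_false]
  rintro ⟨⟨h1, h2⟩, h3, h4⟩
  exact hx (rbar γ - 1, pbar γ) ((List.mem_ofFn' _ _).mpr ⟨γ, rfl⟩)
    ⟨by simp only; linarith, by simp only; linarith⟩

/-- If a feasible schedule exists, the first phase succeeds. -/
theorem IsFeasible.declare_ans {t : Fin n → ℝ} (hr : ∀ j, 0 ≤ r j)
    (hidle : ∀ γ, rbar γ < pbar γ ∨ (rbar γ = 0 ∧ pbar γ = 0))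
    {σ : Equiv.Perm (Fin n)} (hσ : Monotone (r ∘ σ)) (h : IsFeasible r d rbar pbar t) :
    (declare r d (initialRegions rbar pbar) σ).ans = true :=
  (declStage_sound hσ (fun j => (h.1 j).1) (fun j => (h.1 j).2)
    (fun i j hij hle => add_one_le_of_Ioo_inter_Ioo_eq_empty hle (h.2.1 i j hij))
    (h.avoids hr hidle) 0 (Nat.zero_le n)).2.2.2

/-- If the first phase succeeds, the schedule generated by the second phase is feasible. -/
theorem isFeasible_generate (hr : ∀ j, 0 ≤ r j) {σ : Equiv.Perm (Fin n)}
    (hσ : Monotone (r ∘ σ)) {pick : (A : Finset (Fin n)) → A.Nonempty → Fin n}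
    (hpick : IsEarliestDeadlineRule d pick)
    (hans : (declare r d (initialRegions rbar pbar) σ).ans = true) :
    IsFeasible r d rbar pbar
      (generate r (declare r d (initialRegions rbar pbar) σ).F pick).t := by
  rw [← declStage_zero] at hans ⊢
  obtain ⟨start, job, hrun, ht⟩ := exists_isRun (r := r) (d := d)
    (F := (declStage r d (initialRegions rbar pbar) σ 0).F) hr hpick
  have hdist : ∀ k l, k ≠ l →
      Set.Ioo (start k) (start k + 1) ∩ Set.Ioo (start l) (start l + 1) = ∅ := by
    intro k l hkl
    rcases lt_or_gt_of_ne hkl with hlt | hlt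
    · exact Ioo_inter_Ioo_eq_empty_of_add_one_le (hrun.add_one_le k l hlt)
    · rw [Set.inter_comm]
      exact Ioo_inter_Ioo_eq_empty_of_add_one_le (hrun.add_one_le l k hlt)
  refine ⟨fun j => ?_, fun i j hij => ?_, fun j γ => ?_⟩
  · obtain ⟨k, rfl⟩ := hrun.bijective.surjective j
    rw [ht]
    exact ⟨hrun.release_le k, hrun.start_le_deadline hσ hans k⟩
  · obtain ⟨k, rfl⟩ := hrun.bijective.surjective i
    obtain ⟨l, rfl⟩ := hrun.bijective.surjective j
    rw [ht, ht]
    exact hdist k l fun hkl => hij (hkl ▸ rfl)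
  · obtain ⟨k, rfl⟩ := hrun.bijective.surjective j
    rw [ht]
    refine inter_idle_eq_empty (fun I hI => ?_) γ
    obtain ⟨z, hz, -⟩ := hrun.eq_leaveUp k
    rw [hz]
    -- The initial regions are still present at the end of the first phase.
    refine avoids_leaveUp _ z I (regions_subset le_rfl ?_)
    rwa [declStage_last]

end Feasibility

end IITScheduling

theorem mainTheorem3 (n m : ℕ) (r d : Fin n → ℝ) (rbar pbar : Fin m → ℝ)
    (hr : ∀ j, 0 ≤ r j)
    (hidle : ∀ γ, rbar γ < pbar γ ∨ (rbar γ = 0 ∧ pbar γ = 0))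
    (σ : Equiv.Perm (Fin n)) (hσ : Monotone (r ∘ σ))
    (pick : (A : Finset (Fin n)) → A.Nonempty → Fin n)
    (hpick : IITScheduling.IsEarliestDeadlineRule d pick) :
    let out := IITScheduling.polynomial r d (IITScheduling.initialRegions rbar pbar) σ pick
    (out.ans = true ↔ ∃ t : Fin n → ℝ, IITScheduling.IsFeasible r d rbar pbar t) ∧
    ((∃ t : Fin n → ℝ, IITScheduling.IsFeasible r d rbar pbar t) →
      ∃ t : Fin n → ℝ, out.schedule = some t ∧ IITScheduling.IsFeasible r d rbar pbar t) ∧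
    ((¬ ∃ t : Fin n → ℝ, IITScheduling.IsFeasible r d rbar pbar t) → out.schedule = none) := by
  intro out
  have hout : out.schedule = if out.ans = true then
      some (IITScheduling.generate r
        (IITScheduling.declare r d (IITScheduling.initialRegions rbar pbar) σ).F pick).t
    else none := rfl
  have yes : (∃ t, IITScheduling.IsFeasible r d rbar pbar t) → out.ans = true :=
    fun ⟨_, ht⟩ => ht.declare_ans hr hidle hσ
  have feasible := fun h : out.ans = true =>
    IITScheduling.isFeasible_generate (rbar := rbar) (pbar := pbar) hr hσ hpick h
  refine ⟨⟨fun h => ⟨_, feasible h⟩, yes⟩, fun h => ⟨_, ?_, feasible (yes h)⟩, fun h => ?_⟩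
  · rw [hout, if_pos (yes h)]
  · rw [hout, if_neg fun hans => h ⟨_, feasible hans⟩]
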